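/- Let $k$ be a field and $S = k[x_1,x_2,x_3]$. Let $I \subseteq K \subseteq S$ and $J \subseteq L \subseteq S$ be monomial ideals of finite colength (i.e. $\dim_k S/I, \dim_k S/J < \infty$), and let $\phi : K/I \to L/J$ be an isomorphism of $S$-modules that is a monomial map, i.e. it sends the class of each monomial $x^a\in K\smallsetminus I$ to the class of a monomial. Let $N$ be an $S$-module isomorphic to $$\frac{S/I \oplus S/J}{\langle (f, -\phi(f)) : f \in K/I \rangle}.$$ Let $K/I = P_1 \oplus \cdots \oplus P_m$ be the decomposition of $K/I \subseteq S/I$ into indecomposable $\mathbb{N}^3$-graded $S$-submodules (for the grading in which the class of $x^a$ has degree $a$), and suppose that for every $j$ the submodule $P_j \subseteq S/I$ is not contained in the ideal $(x_3)$ of $S/I$. Then $N$ and $S/\operatorname{Ann}_S(N)$ are finite-dimensional over $k$ and $$\dim_k(S/\operatorname{Ann}_S(N)) \leq \dim_k(N).$$ -/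

import Mathlib

noncomputable section

open MvPolynomial

namespace CombModule

variable {k : Type*} [Field k] {n : ℕ}

/-- A monomial ideal of `k[x_1, …, x_n]`: an ideal generated by a set of monomials. -/
def IsMonomialIdeal (I : Ideal (MvPolynomial (Fin n) k)) : Prop :=
  ∃ A : Set (Fin n →₀ ℕ), I = Ideal.span ((fun a => monomial a (1 : k)) '' A)

/-- For ideals `I ⊆ K` of `S`, the `S`-module `K / I`, embedded in `S / I`. -/
def subquot (I K : Ideal (MvPolynomial (Fin n) k)) :
    Submodule (MvPolynomial (Fin n) k) (MvPolynomial (Fin n) k ⧸ I) :=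
  Submodule.map (Submodule.mkQ I) K

/-- The element of `S / I` is the class of a monomial `x^a`. -/
def IsMonomialClass (I : Ideal (MvPolynomial (Fin n) k)) (f : MvPolynomial (Fin n) k ⧸ I) : Prop :=
  ∃ a : Fin n →₀ ℕ, f = Submodule.mkQ I (monomial a (1 : k))

/-- A monomial map `K / I → L / J`: the class of a monomial is sent to the class of a monomial,
or to zero. -/
def IsMonomialMap {I J K L : Ideal (MvPolynomial (Fin n) k)}
    (φ : subquot I K →ₗ[MvPolynomial (Fin n) k] subquot J L) : Prop :=
  ∀ f : subquot I K, IsMonomialClass I (f : MvPolynomial (Fin n) k ⧸ I) →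
    φ f = 0 ∨ IsMonomialClass J (φ f : MvPolynomial (Fin n) k ⧸ J)

/-- The submodule of `S / I ⊕ S / J` generated by the elements `(f, -φ(f))`, `f ∈ K / I`. -/
def gluingRelations {I J K L : Ideal (MvPolynomial (Fin n) k)}
    (φ : subquot I K →ₗ[MvPolynomial (Fin n) k] subquot J L) :
    Submodule (MvPolynomial (Fin n) k)
      ((MvPolynomial (Fin n) k ⧸ I) × (MvPolynomial (Fin n) k ⧸ J)) :=
  Submodule.span (MvPolynomial (Fin n) k)
    (Set.range fun f : subquot I K =>
      ((f : MvPolynomial (Fin n) k ⧸ I), -(φ f : MvPolynomial (Fin n) k ⧸ J)))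

/-- The module arising from `(I, J, K, L, φ)`, obtained by gluing `S / I` and `S / J` along
`K / I ≅ L / J`. -/
abbrev GluedModule {I J K L : Ideal (MvPolynomial (Fin n) k)}
    (φ : subquot I K →ₗ[MvPolynomial (Fin n) k] subquot J L) : Type _ :=
  ((MvPolynomial (Fin n) k ⧸ I) × (MvPolynomial (Fin n) k ⧸ J)) ⧸ gluingRelations φ

/-- The component of degree `a ∈ ℕ^n` of `S / I`, spanned over `k` by the class of `x^a`. -/
def gradedPiece (I : Ideal (MvPolynomial (Fin n) k)) (a : Fin n →₀ ℕ) :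
    Submodule k (MvPolynomial (Fin n) k ⧸ I) :=
  Submodule.span k {Submodule.mkQ I (monomial a (1 : k))}

/-- An `ℕ^n`-graded submodule of `S / I` (for `I` a monomial ideal): an `S`-submodule that is the
sum of its intersections with the graded pieces of `S / I`. -/
def IsGradedSubmodule {I : Ideal (MvPolynomial (Fin n) k)}
    (P : Submodule (MvPolynomial (Fin n) k) (MvPolynomial (Fin n) k ⧸ I)) : Prop :=
  P.restrictScalars k = ⨆ a : Fin n →₀ ℕ, P.restrictScalars k ⊓ gradedPiece I a

/-- An indecomposable `ℕ^n`-graded submodule of `S / I`: a nonzero graded submodule that is not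
the direct sum of two nonzero graded submodules. -/
structure IsGradedIndecomposable {I : Ideal (MvPolynomial (Fin n) k)}
    (P : Submodule (MvPolynomial (Fin n) k) (MvPolynomial (Fin n) k ⧸ I)) : Prop where
  graded : IsGradedSubmodule P
  ne_bot : P ≠ ⊥
  indecomposable : ∀ M M' : Submodule (MvPolynomial (Fin n) k) (MvPolynomial (Fin n) k ⧸ I),
    IsGradedSubmodule M → IsGradedSubmodule M' → M ⊓ M' = ⊥ → M ⊔ M' = P → M = ⊥ ∨ M' = ⊥

/-- `K / I = P_1 ⊕ ⋯ ⊕ P_m` is an `ℕ^n`-graded indecomposable decomposition, each summand being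
given with its embedding in `S / I`. -/
structure IsGradedIndecomposableDecomposition (I K : Ideal (MvPolynomial (Fin n) k)) {m : ℕ}
    (P : Fin m → Submodule (MvPolynomial (Fin n) k) (MvPolynomial (Fin n) k ⧸ I)) : Prop where
  indecomposable : ∀ j, IsGradedIndecomposable (P j)
  independent : iSupIndep P
  iSup_eq : ⨆ j, P j = subquot I K

end CombModule

end

open MvPolynomial

namespace CombModule

/-! The annihilator of the glued module is `I ⊓ J`. Since dim N = dim S/I + dim S/J - dim K/I and
dim S/(I ∩ J) ≤ dim S/I + dim S/J - dim S/(I + J), it suffices that dim K/I ≤ dim S/(I + J)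
(`finrank_subquot_le`). In monomials: the set `D` of exponents in K but not in I is at most as large
as A ∩ B, where A and B are the lower sets of exponents outside I and outside J.

The isomorphism gives each a in `D` a second exponent `b a` in B, and `b` is a translation along
comparable exponents (`exists_exponent_map`). The translation in the third coordinate is therefore
constant on each indecomposable summand; as the summand contains a nonzero monomial free of x_3, it
is nonnegative there. So z ≤ z' throughout.

The count (`card_le_card_inter`) compresses twice. Fix (y', z), mixing the two charts: on this fibre
x and x' are injective, so the fibre can be pushed down to 0, 1, …, giving points in A (with y
minimal on the fibre) and in B (with z in place of z'). Then fix the new first coordinate and z: the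
remaining y' and the minimal y are two injective families in initial segments of ℕ, so there are at
most as many as points of A ∩ B on that line. -/

/-! ### Counting in lower sets of ℕ³ -/

/-- A finite set of natural numbers with more than `j` elements has an element `≥ j`. -/
lemma exists_le_of_lt_card {s : Finset ℕ} {j : ℕ} (h : j < s.card) : ∃ x ∈ s, j ≤ x := by
  by_contra! hc
  have : s ⊆ Finset.range j := fun x hx => Finset.mem_range.2 (hc x hx)
  have := Finset.card_le_card this
  simp at this
  omega

/-- If a finite set lies in an initial segment `B` of `ℕ` and is mapped injectively into an initial
segment `A`, then its cardinality is at most that of `A ∩ B`. -/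
lemma card_le_of_injOn_initial {A B : ℕ → Prop} (hA : ∀ i j, i ≤ j → A j → A i)
    (hB : ∀ i j, i ≤ j → B j → B i) (Y E : Finset ℕ) (τ : ℕ → ℕ) (hτ : Set.InjOn τ Y)
    (hYA : ∀ y ∈ Y, A (τ y)) (hYB : ∀ y ∈ Y, B y) (hE : ∀ y, A y → B y → y ∈ E) :
    Y.card ≤ E.card := by
  -- Both `Y` and its image under `τ` have `Y.card` elements, so each reaches at least as high as
  -- any `i < Y.card`.
  have hsub : Finset.range Y.card ⊆ E := by
    intro i hi
    rw [Finset.mem_range] at hi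
    obtain ⟨y, hy, hiy⟩ := exists_le_of_lt_card hi
    have hi' : i < (Y.image τ).card := by rwa [Finset.card_image_of_injOn hτ]
    obtain ⟨w, hw, hiw⟩ := exists_le_of_lt_card hi'
    obtain ⟨y', hy', rfl⟩ := Finset.mem_image.1 hw
    exact hE i (hA _ _ hiw (hYA _ hy')) (hB _ _ hiy (hYB _ hy))
  simpa using Finset.card_le_card hsub

/-- The counting principle behind the main theorem: a finite set with two coordinate systems, the
first with values in a lower set `A ⊆ ℕ³` and the second in a lower set `B ⊆ ℕ³`, has at most as
many elements as `A ∩ B`. -/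
lemma card_le_card_inter {ι : Type*} (D : Finset ι) (x y z x' y' z' : ι → ℕ)
    (A B : ℕ → ℕ → ℕ → Prop)
    (hA : ∀ p q r p' q' r', p ≤ p' → q ≤ q' → r ≤ r' → A p' q' r' → A p q r)
    (hB : ∀ p q r p' q' r', p ≤ p' → q ≤ q' → r ≤ r' → B p' q' r' → B p q r)
    (hDA : ∀ a ∈ D, A (x a) (y a) (z a)) (hDB : ∀ a ∈ D, B (x' a) (y' a) (z' a))
    (hz : ∀ a ∈ D, z a ≤ z' a)
    (hx : ∀ a ∈ D, ∀ c ∈ D, x a = x c → z a = z c → y' a = y' c → a = c)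
    (hx' : ∀ a ∈ D, ∀ c ∈ D, x' a = x' c → z a = z c → y' a = y' c → a = c)
    (hy : ∀ a ∈ D, ∀ c ∈ D, y a = y c → z a = z c → y' a = y' c)
    (E : Finset (ℕ × ℕ × ℕ)) (hE : ∀ p q r, A p q r → B p q r → (p, q, r) ∈ E) :
    D.card ≤ E.card := by
  classical
  let g : ι → ℕ × ℕ := fun a => (y' a, z a)
  let T : ℕ × ℕ → Finset ι := fun p => D.filter (fun a => g a = p)
  have hT : ∀ p a, a ∈ T p ↔ a ∈ D ∧ y' a = p.1 ∧ z a = p.2 := by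
    intro p a
    simp [T, g, Prod.ext_iff]
  -- First compression: each fibre of `g` is replaced by an initial segment of the same size.
  let F : Finset (Σ _ : ℕ × ℕ, ℕ) := (D.image g).sigma fun p => Finset.range (T p).card
  have hF : ∀ u ∈ F, u.2 < (T u.1).card := by
    intro u hu
    simpa using (Finset.mem_sigma.1 hu).2
  have hcard : D.card = F.card := by
    rw [Finset.card_sigma]
    simp only [Finset.card_range]
    exact Finset.card_eq_sum_card_fiberwise fun a ha => Finset.mem_image_of_mem g ha
  have hne : ∀ u ∈ F, ((T u.1).image y).Nonempty := by
    intro u hu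
    exact (Finset.card_pos.1 (lt_of_le_of_lt (Nat.zero_le _) (hF u hu))).image y
  -- The least `y` on a fibre: a single value for the whole fibre, admissible for `A` at each of its
  -- points because `A` is a lower set.
  let τ : ℕ × ℕ → ℕ := fun p => sInf ((T p).image y : Set ℕ)
  have hτmem : ∀ u ∈ F, ∃ a ∈ T u.1, y a = τ u.1 := by
    intro u hu
    have := Nat.sInf_mem (s := (((T u.1).image y : Finset ℕ) : Set ℕ)) (hne u hu)
    obtain ⟨a, ha, hay⟩ := Finset.mem_image.1 (Finset.mem_coe.1 this)
    exact ⟨a, ha, hay⟩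
  have hτle : ∀ p, ∀ a ∈ T p, τ p ≤ y a := fun p a ha =>
    Nat.sInf_le (Finset.mem_coe.2 (Finset.mem_image_of_mem y ha))
  have hFA : ∀ u ∈ F, A u.2 (τ u.1) u.1.2 := by
    intro u hu
    have hinj : Set.InjOn x (T u.1) := by
      intro a ha c hc hac
      have ha := (hT _ _).1 ha
      have hc := (hT _ _).1 hc
      exact hx a ha.1 c hc.1 hac (ha.2.2.trans hc.2.2.symm) (ha.2.1.trans hc.2.1.symm)
    have h := hF u hu
    rw [← Finset.card_image_of_injOn hinj] at h
    obtain ⟨w, hw, hjw⟩ := exists_le_of_lt_card h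
    obtain ⟨a, ha, rfl⟩ := Finset.mem_image.1 hw
    have ha' := (hT _ _).1 ha
    exact hA _ _ _ _ _ _ hjw (hτle _ a ha) ha'.2.2.ge (hDA a ha'.1)
  have hFB : ∀ u ∈ F, B u.2 u.1.1 u.1.2 := by
    intro u hu
    have hinj : Set.InjOn x' (T u.1) := by
      intro a ha c hc hac
      have ha := (hT _ _).1 ha
      have hc := (hT _ _).1 hc
      exact hx' a ha.1 c hc.1 hac (ha.2.2.trans hc.2.2.symm) (ha.2.1.trans hc.2.1.symm)
    have h := hF u hu
    rw [← Finset.card_image_of_injOn hinj] at h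
    obtain ⟨w, hw, hjw⟩ := exists_le_of_lt_card h
    obtain ⟨a, ha, rfl⟩ := Finset.mem_image.1 hw
    have ha' := (hT _ _).1 ha
    -- Here `z ≤ z'` lets the third coordinate in `B` be lowered to the one used in `A`.
    exact hB _ _ _ _ _ _ hjw ha'.2.1.ge (ha'.2.2.ge.trans (hz a ha'.1)) (hDB a ha'.1)
  let gF : (Σ _ : ℕ × ℕ, ℕ) → ℕ × ℕ := fun u => (u.2, u.1.2)
  let gE : ℕ × ℕ × ℕ → ℕ × ℕ := fun v => (v.1, v.2.2)
  -- Second compression: `F` and `E` are compared line by line, with first and third coordinates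
  -- fixed; the union serves as a common index set.
  rw [hcard, Finset.card_eq_sum_card_fiberwise (f := gF) (t := F.image gF ∪ E.image gE)
      fun u hu => Finset.mem_union_left _ (Finset.mem_image_of_mem gF hu),
    Finset.card_eq_sum_card_fiberwise (f := gE) (t := F.image gF ∪ E.image gE)
      fun u hu => Finset.mem_union_right _ (Finset.mem_image_of_mem gE hu)]
  refine Finset.sum_le_sum fun jz _ => ?_
  obtain ⟨j, r⟩ := jz
  have hinjF : Set.InjOn (fun u : (Σ _ : ℕ × ℕ, ℕ) => u.1.1)
      (F.filter fun u => gF u = (j, r)) := by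
    rintro ⟨⟨p, q⟩, i⟩ hu ⟨⟨p', q'⟩, i'⟩ hv huv
    simp only [gF, Finset.coe_filter, Set.mem_ofPred_eq, Prod.mk.injEq] at hu hv huv
    obtain ⟨-, rfl, rfl⟩ := hu
    obtain ⟨-, rfl, rfl⟩ := hv
    subst huv
    rfl
  have hinjE : Set.InjOn (fun v : ℕ × ℕ × ℕ => v.2.1) (E.filter fun v => gE v = (j, r)) := by
    rintro ⟨p, q, i⟩ hu ⟨p', q', i'⟩ hv huv
    simp only [gE, Finset.coe_filter, Set.mem_ofPred_eq, Prod.mk.injEq] at hu hv huv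
    obtain ⟨-, rfl, rfl⟩ := hu
    obtain ⟨-, rfl, rfl⟩ := hv
    subst huv
    rfl
  rw [← Finset.card_image_of_injOn hinjF, ← Finset.card_image_of_injOn hinjE]
  have hmem : ∀ w ∈ (F.filter fun u => gF u = (j, r)).image (fun u => u.1.1),
      (⟨(w, r), j⟩ : Σ _ : ℕ × ℕ, ℕ) ∈ F := by
    intro w hw
    obtain ⟨⟨⟨p, q⟩, i⟩, hu, rfl⟩ := Finset.mem_image.1 hw
    simp only [gF, Finset.mem_filter, Prod.mk.injEq] at hu
    obtain ⟨hu, rfl, rfl⟩ := hu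
    exact hu
  refine card_le_of_injOn_initial (A := fun q => A j q r) (B := fun q => B j q r)
    (fun _ _ h => hA _ _ _ _ _ _ le_rfl h le_rfl) (fun _ _ h => hB _ _ _ _ _ _ le_rfl h le_rfl)
    _ _ (fun w => τ (w, r)) ?_ (fun w hw => hFA _ (hmem w hw)) (fun w hw => hFB _ (hmem w hw)) ?_
  · intro w hw v hv hwv
    obtain ⟨a, ha, hya⟩ := hτmem _ (hmem w hw)
    obtain ⟨c, hc, hyc⟩ := hτmem _ (hmem v hv)
    have ha := (hT _ _).1 ha
    have hc := (hT _ _).1 hc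
    have h := hy a ha.1 c hc.1 (hya.trans (Eq.trans hwv hyc.symm)) (ha.2.2.trans hc.2.2.symm)
    exact ha.2.1.symm.trans (h.trans hc.2.1)
  · intro q hqA hqB
    exact Finset.mem_image.2 ⟨(j, q, r), by simp [gE, hE _ _ _ hqA hqB], rfl⟩

/-! ### Monomial ideals and monomial bases of quotients -/

section Monomial

variable {k : Type*} [Field k] {n : ℕ}

/-- The monomials of the elements of a monomial ideal lie in the ideal. -/
lemma IsMonomialIdeal.monomial_mem {I : Ideal (MvPolynomial (Fin n) k)} (hI : IsMonomialIdeal I)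
    {f : MvPolynomial (Fin n) k} (hf : f ∈ I) {a : Fin n →₀ ℕ} (ha : a ∈ f.support) :
    monomial a (1 : k) ∈ I := by
  obtain ⟨A, rfl⟩ := hI
  rw [mem_ideal_span_monomial_image] at hf ⊢
  intro b hb
  have : b = a := by
    have := support_monomial_subset hb
    simpa using this
  subst this
  exact hf b ha

lemma IsMonomialIdeal.sup {I J : Ideal (MvPolynomial (Fin n) k)} (hI : IsMonomialIdeal I)
    (hJ : IsMonomialIdeal J) : IsMonomialIdeal (I ⊔ J) := by
  obtain ⟨A, rfl⟩ := hI
  obtain ⟨B, rfl⟩ := hJ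
  exact ⟨A ∪ B, by rw [Set.image_union, Ideal.span_union]⟩

lemma monomial_mem_of_le {I : Ideal (MvPolynomial (Fin n) k)} {a b : Fin n →₀ ℕ} (hab : a ≤ b)
    (ha : monomial a (1 : k) ∈ I) : monomial b (1 : k) ∈ I := by
  have : monomial b (1 : k) = monomial (b - a) 1 * monomial a 1 := by
    rw [monomial_mul, tsub_add_cancel_of_le hab, one_mul]
  rw [this]
  exact I.mul_mem_left _ ha

lemma IsMonomialIdeal.monomial_mem_sup {I J : Ideal (MvPolynomial (Fin n) k)}
    (hI : IsMonomialIdeal I) (hJ : IsMonomialIdeal J) {a : Fin n →₀ ℕ}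
    (h : monomial a (1 : k) ∈ I ⊔ J) : monomial a (1 : k) ∈ I ∨ monomial a (1 : k) ∈ J := by
  obtain ⟨f, hf, g, hg, hfg⟩ := Submodule.mem_sup.1 h
  have ha : a ∈ (f + g).support := by
    rw [hfg]; simp [mem_support_iff]
  rcases Finset.mem_union.1 (support_add ha) with h | h
  · exact Or.inl (hI.monomial_mem hf h)
  · exact Or.inr (hJ.monomial_mem hg h)

/-- Two monomials with the same class modulo a monomial ideal are equal or belong to it. -/
lemma IsMonomialIdeal.eq_of_sub_mem {I : Ideal (MvPolynomial (Fin n) k)} (hI : IsMonomialIdeal I)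
    {a b : Fin n →₀ ℕ} (hab : monomial a (1 : k) - monomial b 1 ∈ I)
    (ha : monomial a (1 : k) ∉ I) : a = b := by
  by_contra hne
  refine ha (hI.monomial_mem hab ?_)
  simp [mem_support_iff, coeff_monomial, Ne.symm hne]

/-- If `f` and `g` agree modulo a monomial ideal, every monomial of `f` is in the ideal or is a
monomial of `g`. -/
lemma IsMonomialIdeal.mem_or_mem_support {I : Ideal (MvPolynomial (Fin n) k)}
    (hI : IsMonomialIdeal I) {f g : MvPolynomial (Fin n) k}
    (hfg : I.mkQ f = I.mkQ g) {a : Fin n →₀ ℕ} (ha : a ∈ f.support) :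
    monomial a (1 : k) ∈ I ∨ a ∈ g.support := by
  by_cases hg : a ∈ g.support
  · exact Or.inr hg
  · left
    have : f - g ∈ I := (Submodule.Quotient.eq I).1 hfg
    refine hI.monomial_mem this ?_
    rw [notMem_support_iff] at hg
    rw [mem_support_iff] at ha ⊢
    simpa [hg] using ha

/-- An element all of whose monomials have classes in `P` has its class in `P`. -/
lemma mkQ_mem_of_support {I : Ideal (MvPolynomial (Fin n) k)}
    {P : Submodule (MvPolynomial (Fin n) k) (MvPolynomial (Fin n) k ⧸ I)}
    {f : MvPolynomial (Fin n) k} (h : ∀ a ∈ f.support, I.mkQ (monomial a (1 : k)) ∈ P) :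
    I.mkQ f ∈ P := by
  rw [f.as_sum, map_sum]
  refine Submodule.sum_mem _ fun a ha => ?_
  have : monomial a (coeff a f) = (C (coeff a f) : MvPolynomial (Fin n) k) • monomial a 1 := by
    rw [smul_eq_mul, C_mul_monomial, mul_one]
  rw [this, map_smul]
  exact P.smul_mem _ (h a ha)

/-- A relation is a polynomial in `I`, and a monomial ideal contains every monomial occurring in its
elements. -/
lemma linearIndependent_mkQ_monomial {I : Ideal (MvPolynomial (Fin n) k)}
    (hI : IsMonomialIdeal I) :
    LinearIndependent k (fun a : {a : Fin n →₀ ℕ // monomial a (1 : k) ∉ I} =>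
      I.mkQ (monomial a.1 (1 : k))) := by
  rw [linearIndependent_iff']
  intro s c hc a ha
  by_contra hne
  refine a.2 (hI.monomial_mem (f := ∑ b ∈ s, c b • monomial b.1 (1 : k)) ?_ ?_)
  · rw [← Submodule.Quotient.mk_eq_zero]
    change I.mkQ _ = 0
    rw [map_sum, ← hc]
    rfl
  · rw [mem_support_iff, coeff_sum, Finset.sum_eq_single a]
    · simpa using hne
    · intro b _ hba
      have : b.1 ≠ a.1 := fun h => hba (Subtype.ext h)
      simp [coeff_monomial, this]
    · exact fun h => absurd ha h

lemma finite_monomial_notMem {I : Ideal (MvPolynomial (Fin n) k)} (hI : IsMonomialIdeal I)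
    (hfin : Module.Finite k (MvPolynomial (Fin n) k ⧸ I)) :
    {a : Fin n →₀ ℕ | monomial a (1 : k) ∉ I}.Finite := by
  have := (linearIndependent_mkQ_monomial hI).finite
  exact Set.finite_coe_iff.1 this

lemma card_le_finrank_quotient {I : Ideal (MvPolynomial (Fin n) k)} (hI : IsMonomialIdeal I)
    (hfin : Module.Finite k (MvPolynomial (Fin n) k ⧸ I)) (E : Finset (Fin n →₀ ℕ))
    (hE : ∀ a ∈ E, monomial a (1 : k) ∉ I) :
    E.card ≤ Module.finrank k (MvPolynomial (Fin n) k ⧸ I) := by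
  have h := (linearIndependent_mkQ_monomial hI).comp
    (fun a : E => (⟨a.1, hE a.1 a.2⟩ : {a : Fin n →₀ ℕ // monomial a (1 : k) ∉ I}))
    (fun a b hab => Subtype.ext (congrArg (fun c => c.1) hab))
  simpa using h.fintype_card_le_finrank

lemma finrank_subquot_le_card {I K : Ideal (MvPolynomial (Fin n) k)} (hK : IsMonomialIdeal K)
    (D : Finset (Fin n →₀ ℕ))
    (hD : ∀ a, monomial a (1 : k) ∈ K → monomial a (1 : k) ∉ I → a ∈ D) :
    Module.finrank k (subquot I K) ≤ D.card := by
  classical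
  let s : Finset (MvPolynomial (Fin n) k ⧸ I) := D.image fun a => I.mkQ (monomial a (1 : k))
  have hle : (subquot I K).restrictScalars k ≤
      Submodule.span k (s : Set (MvPolynomial (Fin n) k ⧸ I)) := by
    rintro _ ⟨f, hf, rfl⟩
    rw [f.as_sum, map_sum]
    refine Submodule.sum_mem _ fun a ha => ?_
    have hr : monomial a (coeff a f) = coeff a f • monomial a (1 : k) := by
      rw [smul_monomial, smul_eq_mul, mul_one]
    have hs : I.mkQ (monomial a (coeff a f)) = coeff a f • I.mkQ (monomial a (1 : k)) := by
      rw [hr]; rfl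
    rw [hs]
    refine Submodule.smul_mem _ _ ?_
    by_cases haI : monomial a (1 : k) ∈ I
    · have : I.mkQ (monomial a (1 : k)) = 0 := (Submodule.Quotient.mk_eq_zero I).2 haI
      rw [this]
      exact Submodule.zero_mem _
    · exact Submodule.subset_span
        (Finset.mem_coe.2 (Finset.mem_image_of_mem _ (hD a (hK.monomial_mem hf ha) haI)))
  have : Module.Finite k (Submodule.span k (s : Set (MvPolynomial (Fin n) k ⧸ I))) :=
    Module.Finite.span_finset k s
  calc Module.finrank k (subquot I K)
      = Module.finrank k ((subquot I K).restrictScalars k) := rfl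
    _ ≤ Module.finrank k (Submodule.span k (s : Set (MvPolynomial (Fin n) k ⧸ I))) :=
        Submodule.finrank_mono hle
    _ ≤ s.card := finrank_span_finset_le_card s
    _ ≤ D.card := Finset.card_image_le

/-! ### Graded submodules and indecomposable summands -/

/-- Every element of a graded submodule is represented by a polynomial whose monomials have
classes in the submodule. -/
lemma IsGradedSubmodule.exists_rep {I : Ideal (MvPolynomial (Fin n) k)}
    {P : Submodule (MvPolynomial (Fin n) k) (MvPolynomial (Fin n) k ⧸ I)}
    (hP : IsGradedSubmodule P) {u : MvPolynomial (Fin n) k ⧸ I} (hu : u ∈ P) :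
    ∃ g : MvPolynomial (Fin n) k, I.mkQ g = u ∧
      ∀ a ∈ g.support, I.mkQ (monomial a (1 : k)) ∈ P := by
  have hu' : u ∈ ⨆ a : Fin n →₀ ℕ, P.restrictScalars k ⊓ gradedPiece I a := by
    rw [← hP]; exact hu
  classical
  refine Submodule.iSup_induction _ (motive := fun u => ∃ g : MvPolynomial (Fin n) k,
    I.mkQ g = u ∧ ∀ a ∈ g.support, I.mkQ (monomial a (1 : k)) ∈ P) hu' ?_ ?_ ?_
  · rintro a v ⟨hvP, hva⟩
    obtain ⟨c, rfl⟩ := Submodule.mem_span_singleton.1 hva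
    by_cases hc : c = 0
    · exact ⟨0, by simp [hc], by simp⟩
    · refine ⟨c • monomial a 1, rfl, fun b hb => ?_⟩
      rw [smul_monomial] at hb
      have hb' : b = a := by simpa using support_monomial_subset hb
      subst hb'
      have h := (P.restrictScalars k).smul_mem c⁻¹ hvP
      rwa [smul_smul, inv_mul_cancel₀ hc, one_smul] at h
  · exact ⟨0, by simp, by simp⟩
  · rintro _ _ ⟨f, rfl, hf⟩ ⟨g, rfl, hg⟩
    refine ⟨f + g, map_add _ _ _, fun a ha => ?_⟩
    rcases Finset.mem_union.1 (support_add ha) with h | h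
    · exact hf a h
    · exact hg a h

/-- The image of a monomial ideal in `S / I` is a graded submodule. -/
lemma IsMonomialIdeal.isGradedSubmodule_map {I Q : Ideal (MvPolynomial (Fin n) k)}
    (hQ : IsMonomialIdeal Q) : IsGradedSubmodule (Submodule.map I.mkQ Q) := by
  refine le_antisymm ?_ (iSup_le fun a => inf_le_left)
  rintro _ ⟨f, hf, rfl⟩
  rw [f.as_sum, map_sum]
  refine Submodule.sum_mem _ fun a ha => ?_
  refine Submodule.mem_iSup_of_mem a ?_
  have hr : monomial a (coeff a f) = coeff a f • monomial a (1 : k) := by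
    rw [smul_monomial, smul_eq_mul, mul_one]
  have hs : I.mkQ (monomial a (coeff a f)) = coeff a f • I.mkQ (monomial a (1 : k)) := by
    rw [hr]; rfl
  rw [hs]
  exact Submodule.smul_mem _ _
    ⟨⟨_, hQ.monomial_mem hf ha, rfl⟩, Submodule.mem_span_singleton_self _⟩

/-- In an indecomposable graded submodule, a property of exponents that is constant along
nonzero multiples holds for all monomials as soon as it holds for one. -/
lemma IsGradedIndecomposable.forall_of_exists {I : Ideal (MvPolynomial (Fin n) k)}
    (hI : IsMonomialIdeal I)
    {P : Submodule (MvPolynomial (Fin n) k) (MvPolynomial (Fin n) k ⧸ I)}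
    (hP : IsGradedIndecomposable P) (p : (Fin n →₀ ℕ) → Prop)
    (hp : ∀ a b, a ≤ b → I.mkQ (monomial a (1 : k)) ∈ P → monomial b (1 : k) ∉ I → (p a ↔ p b))
    {a₀ a : Fin n →₀ ℕ} (h₀P : I.mkQ (monomial a₀ (1 : k)) ∈ P) (h₀I : monomial a₀ (1 : k) ∉ I)
    (h₀ : p a₀) (haP : I.mkQ (monomial a (1 : k)) ∈ P) (haI : monomial a (1 : k) ∉ I) : p a := by
  by_contra hpa
  -- Split `P` into the parts generated by monomials with and without `p`. A monomial outside `I`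
  -- common to both would be a multiple of generators of both kinds, so the sum is direct and one
  -- part vanishes.
  let Q : ((Fin n →₀ ℕ) → Prop) → Ideal (MvPolynomial (Fin n) k) := fun q =>
    Ideal.span ((fun a => monomial a (1 : k)) '' {a | I.mkQ (monomial a (1 : k)) ∈ P ∧ q a})
  have hQmon : ∀ q, IsMonomialIdeal (Q q) := fun q => ⟨_, rfl⟩
  have hmem : ∀ q b, I.mkQ (monomial b (1 : k)) ∈ P → q b →
      I.mkQ (monomial b (1 : k)) ∈ Submodule.map I.mkQ (Q q) := fun q b hb hq =>
    Submodule.mem_map_of_mem (Ideal.subset_span ⟨b, ⟨hb, hq⟩, rfl⟩)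
  have hle : ∀ q, Submodule.map I.mkQ (Q q) ≤ P := by
    intro q
    rw [Submodule.map_le_iff_le_comap, Ideal.span_le]
    rintro _ ⟨b, hb, rfl⟩
    exact hb.1
  have hinf : Submodule.map I.mkQ (Q p) ⊓ Submodule.map I.mkQ (Q fun b => ¬ p b) = ⊥ := by
    rw [eq_bot_iff]
    rintro _ ⟨⟨f, hf, rfl⟩, ⟨g, hg, hgf⟩⟩
    refine mkQ_mem_of_support fun b hb => ?_
    rw [Submodule.mem_bot]
    by_contra hb0
    have hbI : monomial b (1 : k) ∉ I := fun h => hb0 ((Submodule.Quotient.mk_eq_zero I).2 h)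
    have hbg : b ∈ g.support := (hI.mem_or_mem_support hgf.symm hb).resolve_left hbI
    obtain ⟨c, ⟨hcP, hc⟩, hcb⟩ := mem_ideal_span_monomial_image.1 hf b hb
    obtain ⟨d, ⟨hdP, hd⟩, hdb⟩ := mem_ideal_span_monomial_image.1 hg b hbg
    exact hd ((hp d b hdb hdP hbI).2 ((hp c b hcb hcP hbI).1 hc))
  have hsup : Submodule.map I.mkQ (Q p) ⊔ Submodule.map I.mkQ (Q fun b => ¬ p b) = P := by
    refine le_antisymm (sup_le (hle _) (hle _)) fun u hu => ?_
    obtain ⟨g, rfl, hg⟩ := hP.graded.exists_rep hu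
    refine mkQ_mem_of_support fun b hb => ?_
    by_cases hpb : p b
    · exact Submodule.mem_sup_left (hmem _ b (hg b hb) hpb)
    · exact Submodule.mem_sup_right (hmem _ b (hg b hb) hpb)
  rcases hP.indecomposable _ _ (hQmon _).isGradedSubmodule_map (hQmon _).isGradedSubmodule_map
    hinf hsup with h | h
  · have := hmem _ a₀ h₀P h₀
    rw [h, Submodule.mem_bot] at this
    exact h₀I ((Submodule.Quotient.mk_eq_zero I).1 this)
  · have := hmem (fun b => ¬ p b) a haP hpa
    rw [h, Submodule.mem_bot] at this
    exact haI ((Submodule.Quotient.mk_eq_zero I).1 this)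

/-- Adding homogeneous representatives from the summands gives a polynomial each of whose monomials
has its class in some summand; `a` must occur in it, since it is nonzero modulo `I`. -/
lemma IsGradedIndecomposableDecomposition.exists_mem {I K : Ideal (MvPolynomial (Fin n) k)}
    (hI : IsMonomialIdeal I) {m : ℕ}
    {P : Fin m → Submodule (MvPolynomial (Fin n) k) (MvPolynomial (Fin n) k ⧸ I)}
    (hP : IsGradedIndecomposableDecomposition I K P) {a : Fin n →₀ ℕ}
    (haK : monomial a (1 : k) ∈ K) (haI : monomial a (1 : k) ∉ I) :
    ∃ j, I.mkQ (monomial a (1 : k)) ∈ P j := by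
  classical
  have hu : I.mkQ (monomial a (1 : k)) ∈ ⨆ j, P j := by
    rw [hP.iSup_eq]; exact Submodule.mem_map_of_mem haK
  obtain ⟨g, hg, hgP⟩ : ∃ g : MvPolynomial (Fin n) k, I.mkQ g = I.mkQ (monomial a (1 : k)) ∧
      ∀ b ∈ g.support, ∃ j, I.mkQ (monomial b (1 : k)) ∈ P j := by
    refine Submodule.iSup_induction _ (motive := fun u => ∃ g : MvPolynomial (Fin n) k,
      I.mkQ g = u ∧ ∀ b ∈ g.support, ∃ j, I.mkQ (monomial b (1 : k)) ∈ P j) hu ?_ ?_ ?_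
    · intro j u hu
      obtain ⟨g, hg, hgP⟩ := (hP.indecomposable j).graded.exists_rep hu
      exact ⟨g, hg, fun b hb => ⟨j, hgP b hb⟩⟩
    · exact ⟨0, by simp, by simp⟩
    · rintro _ _ ⟨f, rfl, hf⟩ ⟨g, rfl, hg⟩
      refine ⟨f + g, map_add _ _ _, fun a ha => ?_⟩
      rcases Finset.mem_union.1 (support_add ha) with h | h
      · exact hf a h
      · exact hg a h
  have ha : a ∈ (monomial a (1 : k)).support := by simp [mem_support_iff]
  exact hgP a ((hI.mem_or_mem_support hg.symm ha).resolve_left haI)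

/-- A graded submodule of `S / I` not contained in `(x_i)` contains a nonzero monomial class not
divisible by `x_i`. -/
lemma IsGradedSubmodule.exists_monomial_of_not_le {I : Ideal (MvPolynomial (Fin n) k)}
    {P : Submodule (MvPolynomial (Fin n) k) (MvPolynomial (Fin n) k ⧸ I)}
    (hP : IsGradedSubmodule P) (i : Fin n)
    (h : ¬ P ≤ Submodule.map I.mkQ (Ideal.span {(X i : MvPolynomial (Fin n) k)})) :
    ∃ a : Fin n →₀ ℕ, I.mkQ (monomial a (1 : k)) ∈ P ∧ monomial a (1 : k) ∉ I ∧ a i = 0 := by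
  by_contra! hc
  refine h fun u hu => ?_
  obtain ⟨g, rfl, hg⟩ := hP.exists_rep hu
  refine mkQ_mem_of_support fun a ha => ?_
  by_cases haI : monomial a (1 : k) ∈ I
  · have : I.mkQ (monomial a (1 : k)) = 0 := (Submodule.Quotient.mk_eq_zero I).2 haI
    rw [this]
    exact Submodule.zero_mem _
  · refine Submodule.mem_map_of_mem (monomial_mem_of_le (a := Finsupp.single i 1) ?_
      (Ideal.subset_span rfl))
    have := hc a (hg a ha) haI
    exact Finsupp.single_le_iff.2 (Nat.one_le_iff_ne_zero.2 this)

/-! ### Exponents under a monomial isomorphism -/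

/-- A monomial isomorphism `K / I ≅ L / J` is given on monomials by a map of exponents that is a
translation on comparable exponents, and so is its inverse. -/
lemma exists_exponent_map {I J K L : Ideal (MvPolynomial (Fin n) k)}
    (hI : IsMonomialIdeal I) (hJ : IsMonomialIdeal J)
    (φ : subquot I K ≃ₗ[MvPolynomial (Fin n) k] subquot J L)
    (hφ : IsMonomialMap φ.toLinearMap) :
    ∃ b : (Fin n →₀ ℕ) → (Fin n →₀ ℕ),
      (∀ a, monomial a (1 : k) ∈ K → monomial a (1 : k) ∉ I → monomial (b a) (1 : k) ∉ J) ∧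
      (∀ a c, monomial a (1 : k) ∈ K → monomial a (1 : k) ∉ I → monomial c (1 : k) ∈ K →
        monomial c (1 : k) ∉ I → a ≤ c → b c + a = b a + c) ∧
      (∀ a c, monomial a (1 : k) ∈ K → monomial a (1 : k) ∉ I → monomial c (1 : k) ∈ K →
        monomial c (1 : k) ∉ I → b a ≤ b c → b c + a = b a + c) := by
  classical
  have hex : ∀ a, ∃ b : Fin n →₀ ℕ, ∀ h : monomial a (1 : k) ∈ K, monomial a (1 : k) ∉ I →
      (φ ⟨I.mkQ (monomial a 1), Submodule.mem_map_of_mem h⟩ : MvPolynomial (Fin n) k ⧸ J) =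
        J.mkQ (monomial b (1 : k)) := by
    intro a
    by_cases h : monomial a (1 : k) ∈ K ∧ monomial a (1 : k) ∉ I
    -- A monomial map may kill monomials, but an injective one kills none outside `I`.
    · rcases hφ ⟨I.mkQ (monomial a 1), Submodule.mem_map_of_mem h.1⟩ ⟨a, rfl⟩ with h0 | ⟨b, hb⟩
      · refine absurd ?_ h.2
        have h1 := φ.map_eq_zero_iff.1 h0
        exact (Submodule.Quotient.mk_eq_zero I).1 (congrArg Subtype.val h1)
      · exact ⟨b, fun _ _ => hb⟩
    · exact ⟨0, fun h1 h2 => absurd ⟨h1, h2⟩ h⟩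
  choose b hb using hex
  have hbJ : ∀ a, monomial a (1 : k) ∈ K → monomial a (1 : k) ∉ I →
      monomial (b a) (1 : k) ∉ J := by
    intro a hK hI' hJ'
    have h0 := hb a hK hI'
    have hz : J.mkQ (monomial (b a) (1 : k)) = 0 := (Submodule.Quotient.mk_eq_zero J).2 hJ'
    rw [hz] at h0
    have h1 := φ.map_eq_zero_iff.1 (Subtype.ext h0)
    exact hI' ((Submodule.Quotient.mk_eq_zero I).1 (congrArg Subtype.val h1))
  refine ⟨b, hbJ, ?_, ?_⟩
  · intro a c haK haI hcK hcI hac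
    have hmul : (⟨I.mkQ (monomial c 1), Submodule.mem_map_of_mem hcK⟩ : subquot I K) =
        (monomial (c - a) (1 : k)) • ⟨I.mkQ (monomial a 1), Submodule.mem_map_of_mem haK⟩ := by
      apply Subtype.ext
      change I.mkQ _ = monomial (c - a) (1 : k) • I.mkQ _
      rw [← map_smul, smul_eq_mul, monomial_mul, tsub_add_cancel_of_le hac, one_mul]
    have h := hb c hcK hcI
    rw [hmul, map_smul, Submodule.coe_smul, hb a haK haI, ← map_smul, smul_eq_mul, monomial_mul,
      one_mul] at h
    have h' := hJ.eq_of_sub_mem ((Submodule.Quotient.eq J).1 h.symm) (hbJ c hcK hcI)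
    rw [h', add_comm (c - a), add_assoc, tsub_add_cancel_of_le hac]
  · intro a c haK haI hcK hcI hac
    have hmul : φ ⟨I.mkQ (monomial c 1), Submodule.mem_map_of_mem hcK⟩ =
        φ ((monomial (b c - b a) (1 : k)) •
          ⟨I.mkQ (monomial a 1), Submodule.mem_map_of_mem haK⟩) := by
      apply Subtype.ext
      rw [map_smul, Submodule.coe_smul, hb a haK haI, hb c hcK hcI, ← map_smul, smul_eq_mul,
        monomial_mul, tsub_add_cancel_of_le hac, one_mul]
    have h : I.mkQ (monomial c (1 : k)) =
        monomial (b c - b a) (1 : k) • I.mkQ (monomial a (1 : k)) :=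
      congrArg Subtype.val (φ.injective hmul)
    rw [← map_smul, smul_eq_mul, monomial_mul, one_mul] at h
    have h' := hI.eq_of_sub_mem ((Submodule.Quotient.eq I).1 h) hcI
    calc b c + a = b a + (b c - b a + a) := by rw [← add_assoc, add_tsub_cancel_of_le hac]
      _ = b a + c := by rw [← h']

end Monomial

/-! ### Annihilator and dimension of the glued module -/

section Gluing

variable {k : Type*} [Field k] {n : ℕ} {I J K L : Ideal (MvPolynomial (Fin n) k)}

lemma mem_gluingRelations (φ : subquot I K →ₗ[MvPolynomial (Fin n) k] subquot J L)
    {u : (MvPolynomial (Fin n) k ⧸ I) × (MvPolynomial (Fin n) k ⧸ J)} :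
    u ∈ gluingRelations φ ↔ ∃ f : subquot I K,
      ((f : MvPolynomial (Fin n) k ⧸ I), -(φ f : MvPolynomial (Fin n) k ⧸ J)) = u := by
  let F : subquot I K →ₗ[MvPolynomial (Fin n) k]
      (MvPolynomial (Fin n) k ⧸ I) × (MvPolynomial (Fin n) k ⧸ J) :=
    (subquot I K).subtype.prod (-((subquot J L).subtype ∘ₗ φ))
  have hF : gluingRelations φ = LinearMap.range F := by
    have : (Set.range fun f : subquot I K =>
      ((f : MvPolynomial (Fin n) k ⧸ I), -(φ f : MvPolynomial (Fin n) k ⧸ J))) =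
        (LinearMap.range F : Set _) := rfl
    rw [gluingRelations, this, Submodule.span_eq]
  rw [hF]
  rfl

/-- The annihilator of the glued module is `I ∩ J`. -/
lemma annihilator_gluedModule (φ : subquot I K ≃ₗ[MvPolynomial (Fin n) k] subquot J L) :
    Module.annihilator (MvPolynomial (Fin n) k) (GluedModule φ.toLinearMap) = I ⊓ J := by
  ext f
  rw [Module.mem_annihilator]
  constructor
  · intro h
    -- Test `f` on the two generators: if `(f, 0)` or `(0, f)` is a relation `(g, -φ g)`,
    -- injectivity or linearity of `φ` forces `g` and `φ g` to vanish.
    have h1 := h (Submodule.Quotient.mk (I.mkQ 1, 0))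
    have h2 := h (Submodule.Quotient.mk (0, J.mkQ 1))
    rw [← Submodule.Quotient.mk_smul, Submodule.Quotient.mk_eq_zero, mem_gluingRelations] at h1 h2
    obtain ⟨g, hg⟩ := h1
    obtain ⟨g', hg'⟩ := h2
    simp only [Prod.smul_mk, smul_zero, Prod.mk.injEq, ← map_smul, smul_eq_mul, mul_one] at hg hg'
    constructor
    · have h0 : φ g = 0 := Subtype.ext (neg_eq_zero.1 hg.2)
      rw [φ.map_eq_zero_iff.1 h0] at hg
      exact (Submodule.Quotient.mk_eq_zero I).1 hg.1.symm
    · have h0 : g' = 0 := Subtype.ext hg'.1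
      rw [h0] at hg'
      have h1 := hg'.2
      simp only [map_zero, Submodule.coe_zero, neg_zero] at h1
      exact (Submodule.Quotient.mk_eq_zero J).1 h1.symm
  · rintro ⟨hfI, hfJ⟩ u
    obtain ⟨⟨v, w⟩, rfl⟩ := Submodule.Quotient.mk_surjective _ u
    obtain ⟨v, rfl⟩ := Submodule.Quotient.mk_surjective _ v
    obtain ⟨w, rfl⟩ := Submodule.Quotient.mk_surjective _ w
    rw [← Submodule.Quotient.mk_smul]
    have h1 : f • (Submodule.Quotient.mk v : MvPolynomial (Fin n) k ⧸ I) = 0 := by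
      rw [← Submodule.Quotient.mk_smul, Submodule.Quotient.mk_eq_zero]
      exact I.mul_mem_right _ hfI
    have h2 : f • (Submodule.Quotient.mk w : MvPolynomial (Fin n) k ⧸ J) = 0 := by
      rw [← Submodule.Quotient.mk_smul, Submodule.Quotient.mk_eq_zero]
      exact J.mul_mem_right _ hfJ
    rw [Prod.smul_mk, h1, h2]
    exact Submodule.Quotient.mk_zero _

/-- `dim N + dim K / I = dim S / I + dim S / J` for the glued module `N`. -/
lemma finrank_gluedModule_add [Module.Finite k (MvPolynomial (Fin n) k ⧸ I)]
    [Module.Finite k (MvPolynomial (Fin n) k ⧸ J)]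
    (φ : subquot I K →ₗ[MvPolynomial (Fin n) k] subquot J L) :
    Module.finrank k (GluedModule φ) + Module.finrank k (subquot I K) =
      Module.finrank k (MvPolynomial (Fin n) k ⧸ I) +
        Module.finrank k (MvPolynomial (Fin n) k ⧸ J) := by
  let π := (gluingRelations φ).mkQ.restrictScalars k
  have h := LinearMap.finrank_range_add_finrank_ker π
  have hr : LinearMap.range π = ⊤ :=
    LinearMap.range_eq_top.2 (Submodule.mkQ_surjective (gluingRelations φ))
  let F : subquot I K →ₗ[k] (MvPolynomial (Fin n) k ⧸ I) × (MvPolynomial (Fin n) k ⧸ J) :=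
    ((subquot I K).subtype.prod (-((subquot J L).subtype ∘ₗ φ))).restrictScalars k
  have hF : Function.Injective F := fun u v huv => Subtype.ext (congrArg Prod.fst huv)
  have hk : LinearMap.ker π = LinearMap.range F := by
    ext u
    rw [LinearMap.mem_ker]
    exact (Submodule.Quotient.mk_eq_zero _).trans (mem_gluingRelations φ)
  rw [hr, finrank_top, hk, LinearMap.finrank_range_of_inj hF, Module.finrank_prod] at h
  exact h

/-- `S / (I ∩ J)` embeds in `S / I ⊕ S / J`, with cokernel `S / (I + J)`. -/
lemma finite_and_finrank_quotient_inf [Module.Finite k (MvPolynomial (Fin n) k ⧸ I)]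
    [Module.Finite k (MvPolynomial (Fin n) k ⧸ J)] :
    Module.Finite k (MvPolynomial (Fin n) k ⧸ (I ⊓ J)) ∧
    Module.finrank k (MvPolynomial (Fin n) k ⧸ (I ⊓ J)) +
      Module.finrank k (MvPolynomial (Fin n) k ⧸ (I ⊔ J)) ≤
      Module.finrank k (MvPolynomial (Fin n) k ⧸ I) +
        Module.finrank k (MvPolynomial (Fin n) k ⧸ J) := by
  let G : (MvPolynomial (Fin n) k ⧸ (I ⊓ J)) →ₗ[k]
      (MvPolynomial (Fin n) k ⧸ I) × (MvPolynomial (Fin n) k ⧸ J) :=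
    ((Submodule.factor (inf_le_left : I ⊓ J ≤ I)).prod
      (Submodule.factor (inf_le_right : I ⊓ J ≤ J))).restrictScalars k
  have hG : Function.Injective G := by
    rw [injective_iff_map_eq_zero]
    intro u hu
    obtain ⟨f, rfl⟩ := Submodule.Quotient.mk_surjective _ u
    rw [Submodule.Quotient.mk_eq_zero]
    exact ⟨(Submodule.Quotient.mk_eq_zero I).1 (congrArg Prod.fst hu),
      (Submodule.Quotient.mk_eq_zero J).1 (congrArg Prod.snd hu)⟩
  let H : (MvPolynomial (Fin n) k ⧸ I) × (MvPolynomial (Fin n) k ⧸ J) →ₗ[k]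
      MvPolynomial (Fin n) k ⧸ (I ⊔ J) :=
    ((Submodule.factor (le_sup_left : I ≤ I ⊔ J)).coprod
      (-(Submodule.factor (le_sup_right : J ≤ I ⊔ J)))).restrictScalars k
  have hH : LinearMap.range H = ⊤ := by
    refine LinearMap.range_eq_top.2 fun u => ?_
    obtain ⟨f, rfl⟩ := Submodule.Quotient.mk_surjective _ u
    refine ⟨(Submodule.Quotient.mk f, 0), ?_⟩
    simp [H]
  have hle : LinearMap.range G ≤ LinearMap.ker H := by
    rintro _ ⟨u, rfl⟩
    obtain ⟨f, rfl⟩ := Submodule.Quotient.mk_surjective _ u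
    rw [LinearMap.mem_ker]
    simp [G, H]
  have h := LinearMap.finrank_range_add_finrank_ker H
  have h' := Submodule.finrank_mono hle
  rw [hH, finrank_top, Module.finrank_prod] at h
  rw [LinearMap.finrank_range_of_inj hG] at h'
  exact ⟨Module.Finite.of_injective G hG, by omega⟩

lemma finite_quotient_sup [Module.Finite k (MvPolynomial (Fin n) k ⧸ I)] :
    Module.Finite k (MvPolynomial (Fin n) k ⧸ (I ⊔ J)) := by
  let F : (MvPolynomial (Fin n) k ⧸ I) →ₗ[k] MvPolynomial (Fin n) k ⧸ (I ⊔ J) :=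
    (Submodule.factor (le_sup_left : I ≤ I ⊔ J)).restrictScalars k
  have hF : Function.Surjective F := by
    intro u
    obtain ⟨f, rfl⟩ := Submodule.Quotient.mk_surjective _ u
    exact ⟨Submodule.Quotient.mk f, rfl⟩
  exact Module.Finite.of_surjective F hF

end Gluing

/-! ### The bound in three variables and the theorem -/

/-- The exponent of `x_1^p x_2^q x_3^r`. -/
noncomputable def exponent (p q r : ℕ) : Fin 3 →₀ ℕ := Finsupp.equivFunOnFinite.symm ![p, q, r]

lemma exponent_le {p q r p' q' r' : ℕ} (hp : p ≤ p') (hq : q ≤ q') (hr : r ≤ r') :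
    exponent p q r ≤ exponent p' q' r' := by
  intro i
  fin_cases i <;> simpa [exponent]

lemma exponent_apply (a : Fin 3 →₀ ℕ) : exponent (a 0) (a 1) (a 2) = a := by
  ext i
  fin_cases i <;> simp [exponent]

/-- The dimension of `K / I` is at most that of `S / (I + J)`. -/
lemma finrank_subquot_le {k : Type*} [Field k] {I J K L : Ideal (MvPolynomial (Fin 3) k)}
    (hI : IsMonomialIdeal I) (hJ : IsMonomialIdeal J) (hK : IsMonomialIdeal K)
    (hIfin : Module.Finite k (MvPolynomial (Fin 3) k ⧸ I))
    (φ : subquot I K ≃ₗ[MvPolynomial (Fin 3) k] subquot J L)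
    (hφ : IsMonomialMap φ.toLinearMap) {m : ℕ}
    (P : Fin m → Submodule (MvPolynomial (Fin 3) k) (MvPolynomial (Fin 3) k ⧸ I))
    (hP : IsGradedIndecomposableDecomposition I K P)
    (hx : ∀ j, ¬ P j ≤
      Submodule.map (Submodule.mkQ I) (Ideal.span {(X 2 : MvPolynomial (Fin 3) k)})) :
    Module.finrank k (subquot I K) ≤ Module.finrank k (MvPolynomial (Fin 3) k ⧸ (I ⊔ J)) := by
  classical
  obtain ⟨b, hbJ, hb, hb'⟩ := exists_exponent_map hI hJ φ hφ
  have hAfin := finite_monomial_notMem hI hIfin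
  let D : Finset (Fin 3 →₀ ℕ) := hAfin.toFinset.filter fun a => monomial a (1 : k) ∈ K
  have hD : ∀ a, a ∈ D ↔ monomial a (1 : k) ∉ I ∧ monomial a (1 : k) ∈ K := by
    intro a
    simp [D]
  have hshift : ∀ a c, a ≤ c → a ∈ D → c ∈ D → b c + a = b a + c := fun a c hac ha hc =>
    hb a c ((hD a).1 ha).2 ((hD a).1 ha).1 ((hD c).1 hc).2 ((hD c).1 hc).1 hac
  have hshift' : ∀ a c, b a ≤ b c → a ∈ D → c ∈ D → b c + a = b a + c := fun a c hac ha hc =>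
    hb' a c ((hD a).1 ha).2 ((hD a).1 ha).1 ((hD c).1 hc).2 ((hD c).1 hc).1 hac
  have hPD : ∀ j a, I.mkQ (monomial a (1 : k)) ∈ P j → monomial a (1 : k) ∉ I → a ∈ D := by
    intro j a ha haI
    have : I.mkQ (monomial a (1 : k)) ∈ subquot I K := by
      rw [← hP.iSup_eq]; exact Submodule.mem_iSup_of_mem j ha
    obtain ⟨f, hf, hfa⟩ := this
    have has : a ∈ (monomial a (1 : k)).support := by simp [mem_support_iff]
    exact (hD a).2 ⟨haI,
      hK.monomial_mem hf ((hI.mem_or_mem_support hfa.symm has).resolve_left haI)⟩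
  have hz : ∀ a ∈ D, a 2 ≤ b a 2 := by
    intro a ha
    have ha' := (hD a).1 ha
    obtain ⟨j, hj⟩ := hP.exists_mem hI ha'.2 ha'.1
    obtain ⟨a₀, h₀P, h₀I, h₀⟩ :=
      (hP.indecomposable j).graded.exists_monomial_of_not_le 2 (hx j)
    -- Comparable exponents have equal shifts, so the sign of the third shift propagates through the
    -- summand from `a₀`, where the third exponent is 0.
    refine (hP.indecomposable j).forall_of_exists hI (fun a => a 2 ≤ b a 2) ?_ h₀P h₀I
      (by rw [h₀]; exact Nat.zero_le _) hj ha'.1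
    intro c d hcd hcP hdI
    have hcI : monomial c (1 : k) ∉ I := fun h => hdI (monomial_mem_of_le hcd h)
    have hcD := hPD j c hcP hcI
    have hdD : d ∈ D := (hD d).2 ⟨hdI, monomial_mem_of_le hcd ((hD c).1 hcD).2⟩
    have h := DFunLike.congr_fun (hshift c d hcd hcD hdD) 2
    simp only [Finsupp.add_apply] at h
    omega
  have hsupfin : Module.Finite k (MvPolynomial (Fin 3) k ⧸ (I ⊔ J)) :=
    finite_quotient_sup
  have hIJ := hI.sup hJ
  have hEfin := finite_monomial_notMem hIJ hsupfin
  let E := hEfin.toFinset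
  have hle : ∀ a c : Fin 3 →₀ ℕ, a 0 ≤ c 0 → a 1 ≤ c 1 → a 2 ≤ c 2 → a ≤ c := by
    intro a c h0 h1 h2 i
    fin_cases i <;> assumption
  have hkey : D.card ≤ (E.image fun a => (a 0, a 1, a 2)).card := by
    refine card_le_card_inter D (fun a => a 0) (fun a => a 1) (fun a => a 2)
      (fun a => b a 0) (fun a => b a 1) (fun a => b a 2)
      (fun p q r => monomial (exponent p q r) (1 : k) ∉ I)
      (fun p q r => monomial (exponent p q r) (1 : k) ∉ J)
      (fun p q r p' q' r' hp hq hr h h' => h (monomial_mem_of_le (exponent_le hp hq hr) h'))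
      (fun p q r p' q' r' hp hq hr h h' => h (monomial_mem_of_le (exponent_le hp hq hr) h'))
      ?_ ?_ hz ?_ ?_ ?_ _ ?_
    · intro a ha
      rw [exponent_apply]
      exact ((hD a).1 ha).1
    · intro a ha
      rw [exponent_apply]
      exact hbJ a ((hD a).1 ha).2 ((hD a).1 ha).1
    -- Exponents differing in at most one coordinate are comparable, hence equally shifted; equal `b
    -- a 1` then forces equal `a 1`.
    · have key : ∀ a ∈ D, ∀ c ∈ D, a 0 = c 0 → a 2 = c 2 → b a 1 = b c 1 → a 1 ≤ c 1 → a = c := by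
        intro a ha c hc h0 h2 hb1 h1
        have h := DFunLike.congr_fun (hshift a c (hle a c h0.le h1 h2.le) ha hc) 1
        simp only [Finsupp.add_apply] at h
        rw [← exponent_apply a, ← exponent_apply c, h0, h2, show a 1 = c 1 by omega]
      intro a ha c hc h0 h2 hb1
      rcases le_total (a 1) (c 1) with h | h
      · exact key a ha c hc h0 h2 hb1 h
      · exact (key c hc a ha h0.symm h2.symm hb1.symm h).symm
    -- Here it is the images that are comparable, so translation for the inverse map applies.
    · have key : ∀ a ∈ D, ∀ c ∈ D, b a 0 = b c 0 → a 2 = c 2 → b a 1 = b c 1 →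
          b a 2 ≤ b c 2 → a = c := by
        intro a ha c hc h0 h2 hb1 hb2
        have h := hshift' a c (hle _ _ h0.le hb1.le hb2) ha hc
        have e0 := DFunLike.congr_fun h 0
        have e1 := DFunLike.congr_fun h 1
        simp only [Finsupp.add_apply] at e0 e1
        rw [← exponent_apply a, ← exponent_apply c, h2, show a 0 = c 0 by omega,
          show a 1 = c 1 by omega]
      intro a ha c hc h0 h2 hb1
      rcases le_total (b a 2) (b c 2) with h | h
      · exact key a ha c hc h0 h2 hb1 h
      · exact (key c hc a ha h0.symm h2.symm hb1.symm h).symm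
    · have key : ∀ a ∈ D, ∀ c ∈ D, a 1 = c 1 → a 2 = c 2 → a 0 ≤ c 0 → b a 1 = b c 1 := by
        intro a ha c hc h1 h2 h0
        have h := DFunLike.congr_fun (hshift a c (hle a c h0 h1.le h2.le) ha hc) 1
        simp only [Finsupp.add_apply] at h
        omega
      intro a ha c hc h1 h2
      rcases le_total (a 0) (c 0) with h | h
      · exact key a ha c hc h1 h2 h
      · exact (key c hc a ha h1.symm h2.symm h).symm
    · intro p q r hA hB
      refine Finset.mem_image.2 ⟨exponent p q r, ?_, by simp [exponent]⟩
      rw [Set.Finite.mem_toFinset]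
      exact fun h => (hI.monomial_mem_sup hJ h).elim hA hB
  calc Module.finrank k (subquot I K) ≤ D.card :=
        finrank_subquot_le_card hK D fun a haK haI => (hD a).2 ⟨haI, haK⟩
    _ ≤ _ := hkey
    _ ≤ E.card := Finset.card_image_le
    _ ≤ _ := card_le_finrank_quotient hIJ hsupfin E fun a ha => (Set.Finite.mem_toFinset _).1 ha

end CombModule

theorem mainTheorem1 {k : Type*} [Field k]
    (I J K L : Ideal (MvPolynomial (Fin 3) k))
    (hI : CombModule.IsMonomialIdeal I) (hJ : CombModule.IsMonomialIdeal J)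
    (hK : CombModule.IsMonomialIdeal K) (hL : CombModule.IsMonomialIdeal L)
    (hIfin : Module.Finite k (MvPolynomial (Fin 3) k ⧸ I))
    (hJfin : Module.Finite k (MvPolynomial (Fin 3) k ⧸ J))
    (hIK : I ≤ K) (hJL : J ≤ L)
    (φ : CombModule.subquot I K ≃ₗ[MvPolynomial (Fin 3) k] CombModule.subquot J L)
    (hφ : CombModule.IsMonomialMap φ.toLinearMap)
    {N : Type*} [AddCommGroup N] [Module k N] [Module (MvPolynomial (Fin 3) k) N]
    [IsScalarTower k (MvPolynomial (Fin 3) k) N]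
    (e : N ≃ₗ[MvPolynomial (Fin 3) k] CombModule.GluedModule φ.toLinearMap)
    {m : ℕ} (P : Fin m → Submodule (MvPolynomial (Fin 3) k) (MvPolynomial (Fin 3) k ⧸ I))
    (hP : CombModule.IsGradedIndecomposableDecomposition I K P)
    (hx : ∀ j, ¬ P j ≤
      Submodule.map (Submodule.mkQ I) (Ideal.span {(MvPolynomial.X 2 : MvPolynomial (Fin 3) k)})) :
    Module.Finite k N ∧
      Module.Finite k (MvPolynomial (Fin 3) k ⧸ Module.annihilator (MvPolynomial (Fin 3) k) N) ∧
      Module.finrank k (MvPolynomial (Fin 3) k ⧸ Module.annihilator (MvPolynomial (Fin 3) k) N) ≤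
        Module.finrank k N := by
  have hann : Module.annihilator (MvPolynomial (Fin 3) k) N = I ⊓ J := by
    rw [e.annihilator_eq, CombModule.annihilator_gluedModule]
  have e' := e.restrictScalars k
  have hN : Module.finrank k N = Module.finrank k (CombModule.GluedModule φ.toLinearMap) :=
    e'.finrank_eq
  have h1 := CombModule.finrank_gluedModule_add φ.toLinearMap
  obtain ⟨hfin, h2⟩ := CombModule.finite_and_finrank_quotient_inf (k := k) (I := I) (J := J)
  have h3 := CombModule.finrank_subquot_le hI hJ hK hIfin φ hφ P hP hx
  have hG : Module.Finite k (CombModule.GluedModule φ.toLinearMap) :=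
    Module.Finite.quotient k (CombModule.gluingRelations φ.toLinearMap)
  rw [hann]
  refine ⟨Module.Finite.equiv e'.symm, hfin, ?_⟩
  rw [hN]
  -- Adding dim S/(I + J) to both sides reduces the claim to dim K/I ≤ dim S/(I + J).
  refine le_of_add_le_add_right (h2.trans ?_)
  rw [← h1]
  exact add_le_add_right h3 _
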